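/- Let $V=\coprod_{n\in\mathbb Z}V_n$ be a vertex operator algebra over $\mathbb C$, with vacuum $\mathbf 1$, conformal vector $\omega$, $Y(\omega,x)=\sum_{n}L(n)x^{-n-2}$, and $V_n$ the $n$-eigenspace of $L(0)$ (finite-dimensional, and zero for $n$ sufficiently negative). Let $W=\coprod_{h\in\mathbb C}W_h$ be a $V$-module, where $W_h$ is the $h$-eigenspace of $L(0)$ on $W$ (finite-dimensional, and zero if the real part of $h$ is sufficiently negative). Let $V_{\mathbb Z}$ be an integral form of $V$: the $\mathbb Z$-span of a $\mathbb C$-basis of $V$ which contains $\mathbf 1$, is closed under all products $u_nv$ ($u,v\in V_{\mathbb Z}$, $n\in\mathbb Z$), where $Y(u,x)=\sum_n u_nx^{-n-1}$, and satisfies $V_{\mathbb Z}=\coprod_{n}V_n\cap V_{\mathbb Z}$. Let $W_{\mathbb Z}$ be an integral form of $W$: the $\mathbb Z$-span of a $\mathbb C$-basis of $W$ such that $v_nw\in W_{\mathbb Z}$ for all $v\in V_{\mathbb Z}$, $w\in W_{\mathbb Z}$, $n\in\mathbb Z$, and $W_{\mathbb Z}=\coprod_hW_h\cap W_{\mathbb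 Z}$. Let $W'=\coprod_hW_h^*$ be the contragredient module (the linear functionals on $W$ that vanish on all but finitely many $W_h$), with vertex operators $Y'(v,x)=\sum_n v_nx^{-n-1}$ given by $$\langle Y'(v,x)w',w\rangle=\langle w',Y_W(e^{xL(1)}(-x^{-2})^{L(0)}v,x^{-1})w\rangle ,$$ and let $$W'_{\mathbb Z}=\{w'\in W' : \langle w',w\rangle\in\mathbb Z\text{ for all }w\in W_{\mathbb Z}\}.$$ Suppose that $\frac{L(1)^n}{n!}V_{\mathbb Z}\subseteq V_{\mathbb Z}$ for all $n\ge 0$. Then $W'_{\mathbb Z}$ is invariant under the action of $V_{\mathbb Z}$ on $W'$: for all $v\in V_{\mathbb Z}$, $w'\in W'_{\mathbb Z}$ and $n\in\mathbb Z$ one has $v_nw'\in W'_{\mathbb Z}$; that is, $Y'(v,x)w'\in W'_{\mathbb Z}[[x,x^{-1}]]$. -/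

import Mathlib

noncomputable section

universe u w

/-- The mode `u_n` of the vertex operator `Y(u, x) = ∑ u_n x ^ (-n - 1)`, for a vertex operator map
`Y` on `M`. Since a `VertexOperator` takes values in Laurent series, `u_n x = 0` for `n` large. -/
def vertexMode {V : Type u} {M : Type w} [AddCommGroup V] [Module ℂ V] [AddCommGroup M]
    [Module ℂ M] (Y : V →ₗ[ℂ] VertexOperator ℂ M) (v : V) (n : ℤ) : Module.End ℂ M :=
  VertexOperator.ncoeff (Y v) n

/-- The Jacobi identity of a vertex algebra (`M = V`, `YM = Y`) or of a module, written in
coefficients: the coefficient of `x₀ ^ (-l - 1) * x₁ ^ (-m - 1) * x₂ ^ (-n - 1)` for all integers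
`l, m, n`. By truncation, all the sums have only finitely many nonzero terms. -/
def JacobiIdentity {V : Type u} {M : Type w} [AddCommGroup V] [Module ℂ V] [AddCommGroup M]
    [Module ℂ M] (Y : V →ₗ[ℂ] VertexOperator ℂ V) (YM : V →ₗ[ℂ] VertexOperator ℂ M) : Prop :=
  ∀ (u v : V) (x : M) (l m n : ℤ),
    (∑ᶠ i : ℕ, ((-1) ^ i * Ring.choose l i : ℤ) •
        vertexMode YM u (m + l - i) (vertexMode YM v (n + i) x)) -
      (∑ᶠ i : ℕ, ((-1) ^ i * Ring.choose l i * (l.negOnePow : ℤ) : ℤ) •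
        vertexMode YM v (n + l - i) (vertexMode YM u (m + i) x)) =
    ∑ᶠ i : ℕ, (Ring.choose m i : ℤ) • vertexMode YM (vertexMode Y u (l + i) v) (m + n - i) x

/-- A vertex algebra structure on the complex vector space `V`. -/
structure VertexAlgebra (V : Type u) [AddCommGroup V] [Module ℂ V] where
  /-- The vertex operator map `v ↦ Y(v, x)`. -/
  Y : V →ₗ[ℂ] VertexOperator ℂ V
  /-- The vacuum vector. -/
  vacuum : V
  /-- `Y(𝟏, x)` is the identity. -/
  vacuum_mode : ∀ n : ℤ, vertexMode Y vacuum n = if n = -1 then 1 else 0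
  /-- `Y(v, x)𝟏` has no pole. -/
  creation_regular : ∀ (v : V) (n : ℤ), 0 ≤ n → vertexMode Y v n vacuum = 0
  /-- The constant term of `Y(v, x)𝟏` is `v`. -/
  creation : ∀ v : V, vertexMode Y v (-1) vacuum = v
  jacobi : JacobiIdentity Y Y

/-- A vertex operator algebra structure on the complex vector space `V`. The space of weight `n` is
the eigenspace of `L(0)` with eigenvalue `n`, where `L(n) = ω_{n + 1}`. -/
structure VertexOperatorAlgebra (V : Type u) [AddCommGroup V] [Module ℂ V] extends
    VertexAlgebra V where
  /-- The conformal vector. -/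
  ω : V
  /-- The central charge. -/
  c : ℂ
  virasoro : ∀ m n : ℤ,
    vertexMode Y ω (m + 1) * vertexMode Y ω (n + 1) -
        vertexMode Y ω (n + 1) * vertexMode Y ω (m + 1) =
      ((m - n : ℤ) : ℂ) • vertexMode Y ω (m + n + 1) +
        (if m + n = 0 then ((m : ℂ) ^ 3 - m) / 12 * c else 0) • (1 : Module.End ℂ V)
  /-- `Y(L(-1)v, x)` is the derivative of `Y(v, x)`. -/
  derivative : ∀ (v : V) (n : ℤ),
    vertexMode Y (vertexMode Y ω 0 v) n = (-(n : ℂ)) • vertexMode Y v (n - 1)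
  graded : DirectSum.IsInternal fun n : ℤ => (vertexMode Y ω 1).eigenspace (n : ℂ)
  finite_weight : ∀ n : ℤ, FiniteDimensional ℂ ((vertexMode Y ω 1).eigenspace (n : ℂ))
  weights_bounded : ∃ N : ℤ, ∀ n < N, (vertexMode Y ω 1).eigenspace (n : ℂ) = ⊥

namespace VertexOperatorAlgebra

variable {V : Type u} [AddCommGroup V] [Module ℂ V] (A : VertexOperatorAlgebra V)

/-- The Virasoro operator `L(n)` on `V`. -/
def L (n : ℤ) : Module.End ℂ V := vertexMode A.Y A.ω (n + 1)

/-- The space `V_n` of vectors of weight `n`. -/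
def weightSpace (n : ℤ) : Submodule ℂ V := (A.L 0).eigenspace (n : ℂ)

theorem isInternal_weightSpace : DirectSum.IsInternal A.weightSpace := A.graded

/-- The projection of `V` onto `V_n`, along the other weight spaces. -/
def weightProj (n : ℤ) : Module.End ℂ V :=
  (A.weightSpace n).subtype ∘ₗ
    DirectSum.component ℂ ℤ (fun k => A.weightSpace k) n ∘ₗ
      ((LinearEquiv.ofBijective (DirectSum.coeLinearMap A.weightSpace)
        A.isInternal_weightSpace).symm : V →ₗ[ℂ] DirectSum ℤ fun k => A.weightSpace k)

end VertexOperatorAlgebra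

/-- A module structure on the complex vector space `W` for the vertex operator algebra `A`. The
weights, i.e. the eigenvalues of `L(0)` on `W`, are allowed to be complex. -/
structure VertexOperatorAlgebra.Mod {V : Type u} [AddCommGroup V] [Module ℂ V]
    (A : VertexOperatorAlgebra V) (W : Type w) [AddCommGroup W] [Module ℂ W] where
  /-- The vertex operator map `v ↦ Y_W(v, x)`. -/
  Y : V →ₗ[ℂ] VertexOperator ℂ W
  vacuum_mode : ∀ n : ℤ, vertexMode Y A.vacuum n = if n = -1 then 1 else 0
  jacobi : JacobiIdentity A.Y Y
  graded : DirectSum.IsInternal fun h : ℂ => (vertexMode Y A.ω 1).eigenspace h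
  finite_weight : ∀ h : ℂ, FiniteDimensional ℂ ((vertexMode Y A.ω 1).eigenspace h)
  weights_bounded : ∃ N : ℝ, ∀ h : ℂ, h.re < N → (vertexMode Y A.ω 1).eigenspace h = ⊥

namespace VertexOperatorAlgebra.Mod

variable {V : Type u} [AddCommGroup V] [Module ℂ V] {A : VertexOperatorAlgebra V}
  {W : Type w} [AddCommGroup W] [Module ℂ W] (M : A.Mod W)

/-- The space `W_h` of vectors of weight `h`. -/
def weightSpace (h : ℂ) : Submodule ℂ W := (vertexMode M.Y A.ω 1).eigenspace h

/-- The underlying space `W'` of the contragredient module: the graded dual of `W`, that is, the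
direct sum of the `(W_h)^*`, realized as the space of the linear functionals on `W` that vanish on
all but finitely many weight spaces. -/
def contragredient : Submodule ℂ (Module.Dual ℂ W) where
  carrier := {f | {h : ℂ | ¬ M.weightSpace h ≤ LinearMap.ker f}.Finite}
  zero_mem' := by simp
  add_mem' := by
    intro f g hf hg
    refine (hf.union hg).subset fun h hh => ?_
    by_contra hcon
    simp only [Set.mem_union, Set.mem_ofPred_eq, not_or, not_not] at hcon
    refine hh fun x hx => ?_
    have h1 := hcon.1 hx
    have h2 := hcon.2 hx
    simp only [LinearMap.mem_ker] at h1 h2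
    simp [h1, h2]
  smul_mem' := by
    intro c f hf
    refine hf.subset fun h hh => ?_
    simp only [Set.mem_ofPred_eq] at hh ⊢
    refine fun hle => hh fun x hx => ?_
    have h1 := hle hx
    simp only [LinearMap.mem_ker] at h1
    simp [h1]

/-- The coefficient of `x ^ (-n - 1)` in the opposite vertex operator
`Y_W(e ^ (x L(1)) (-x ^ (-2)) ^ L(0) v, x⁻¹)`. If `v` has weight `k`, this series equals
`∑ (-1) ^ k / j! * x ^ (j - 2 * k) * Y_W(L(1) ^ j v, x⁻¹)`, summed over the natural numbers `j`,
where only finitely many terms are nonzero; in general one sums over the homogeneous components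
of `v`. -/
def oppositeMode (v : V) (n : ℤ) : Module.End ℂ W :=
  ∑ᶠ k : ℤ, ∑ᶠ j : ℕ, ((-1 : ℂ) ^ k / (j.factorial : ℂ)) •
    vertexMode M.Y ((A.L 1 ^ j) (A.weightProj k v)) (2 * k - j - n - 2)

/-- The mode `v_n` of the contragredient vertex operator `Y'(v, x) = ∑ v_n x ^ (-n - 1)`, defined by
`⟨Y'(v, x)w', w⟩ = ⟨w', Y_W(e ^ (x L(1)) (-x ^ (-2)) ^ L(0) v, x⁻¹)w⟩`.
The formula makes sense for every linear functional on `W`. -/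
def contragredientMode (v : V) (n : ℤ) : Module.End ℂ (Module.Dual ℂ W) :=
  (M.oppositeMode v n).dualMap

end VertexOperatorAlgebra.Mod

/-- `S` is an integral form of the complex vector space `V`: the `ℤ`-span of a basis of `V`. -/
def IsVectorSpaceIntegralForm {V : Type u} [AddCommGroup V] [Module ℂ V]
    (S : Submodule ℤ V) : Prop :=
  ∃ (ι : Type u) (b : Module.Basis ι ℂ V), S = Submodule.span ℤ (Set.range b)

/-- `VZ` is an integral form of the vertex operator algebra `A`: an integral form of the vector
space which contains the vacuum, is closed under all products `u_n v`, and is compatible with the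
weight grading (the sum in `graded` is direct, because the weight spaces are independent). -/
structure VertexOperatorAlgebra.IsIntegralForm {V : Type u} [AddCommGroup V] [Module ℂ V]
    (A : VertexOperatorAlgebra V) (VZ : Submodule ℤ V) : Prop where
  integral : IsVectorSpaceIntegralForm VZ
  vacuum_mem : A.vacuum ∈ VZ
  mode_mem : ∀ u ∈ VZ, ∀ v ∈ VZ, ∀ n : ℤ, vertexMode A.Y u n v ∈ VZ
  graded : VZ = ⨆ n : ℤ, (A.weightSpace n).restrictScalars ℤ ⊓ VZ

namespace VertexOperatorAlgebra.Mod

variable {V : Type u} [AddCommGroup V] [Module ℂ V] {A : VertexOperatorAlgebra V}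
  {W : Type w} [AddCommGroup W] [Module ℂ W] (M : A.Mod W)

/-- `WZ` is an integral form of the module `M`, relative to the integral form `VZ` of `A`: an
integral form of the vector space which is preserved by the vertex operators of `VZ` and is
compatible with the weight grading. -/
structure IsIntegralForm (VZ : Submodule ℤ V) (WZ : Submodule ℤ W) : Prop where
  integral : IsVectorSpaceIntegralForm WZ
  mode_mem : ∀ v ∈ VZ, ∀ x ∈ WZ, ∀ n : ℤ, vertexMode M.Y v n x ∈ WZ
  graded : WZ = ⨆ h : ℂ, (M.weightSpace h).restrictScalars ℤ ⊓ WZ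

/-- The dual lattice `W'_ℤ` of `WZ`: the elements of the graded dual `W'` that take integral values
on `WZ`. -/
def dualLattice (WZ : Submodule ℤ W) : Submodule ℤ (Module.Dual ℂ W) where
  carrier := {f | f ∈ M.contragredient ∧ ∀ x ∈ WZ, ∃ m : ℤ, f x = m}
  zero_mem' := ⟨zero_mem _, fun x _ => ⟨0, by simp⟩⟩
  add_mem' := by
    rintro f g ⟨hf, hf'⟩ ⟨hg, hg'⟩
    refine ⟨add_mem hf hg, fun x hx => ?_⟩
    obtain ⟨a, ha⟩ := hf' x hx
    obtain ⟨b, hb⟩ := hg' x hx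
    exact ⟨a + b, by simp [ha, hb]⟩
  smul_mem' := by
    rintro c f ⟨hf, hf'⟩
    refine ⟨zsmul_mem hf c, fun x hx => ?_⟩
    obtain ⟨a, ha⟩ := hf' x hx
    exact ⟨c * a, by simp [ha]⟩

end VertexOperatorAlgebra.Mod

end

/-! The action of `v_n` on `W'` is dual to the opposite mode, a sum over `k` and `j` of terms
`(-1)^k` times a mode of `L(1)^j/j!` applied to the weight-`k` part of `v`. Two things are needed.
Integrality: the grading of the lattice keeps weight parts in `V_ℤ`, the hypothesis on `L(1)`
absorbs `1/j!`, and modes of `V_ℤ` preserve `W_ℤ` (`oppositeMode_mem_of_integral`). Membership in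
`W'`: the terms with given `k` all shift weights by `n + 1 - k`, whatever `j` is, and only finitely
many `k` occur (`contragredientMode_mem_contragredient`). The shift comes from commuting `L(0)` past
a mode, using the `L(-1)`-derivative property on `W`. -/

section Modes

variable {V : Type*} [AddCommGroup V] [Module ℂ V]

/-- The case `l = 0`, `m = 1` of the Jacobi identity. -/
theorem JacobiIdentity.commutator_one {M : Type*} [AddCommGroup M] [Module ℂ M]
    {Y : V →ₗ[ℂ] VertexOperator ℂ V} {YM : V →ₗ[ℂ] VertexOperator ℂ M}
    (hJ : JacobiIdentity Y YM) (u v : V) (x : M) (n : ℤ) :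
    vertexMode YM u 1 (vertexMode YM v n x) - vertexMode YM v n (vertexMode YM u 1 x) =
      vertexMode YM (vertexMode Y u 0 v) (n + 1) x + vertexMode YM (vertexMode Y u 1 v) n x := by
  have h := hJ u v x 0 1 n
  rw [finsum_eq_single _ 0, finsum_eq_single _ 0,
    finsum_eq_sum_of_support_subset (s := Finset.range 2)] at h
  · simpa [Finset.sum_range_succ, add_comm] using h
  · intro i hi
    by_contra hcon
    have h2 : 1 < i := by simpa using hcon
    apply hi
    have : Ring.choose (1 : ℤ) i = 0 := by
      have := Ring.choose_natCast (R := ℤ) 1 i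
      simpa [Nat.choose_eq_zero_of_lt h2] using this
    simp [this]
  all_goals
    intro i hi
    simp [Ring.choose_zero_pos ℤ (Nat.pos_of_ne_zero hi)]

/-! ### Weight components and `L(1)` on `V`. -/

namespace VertexOperatorAlgebra

variable (A : VertexOperatorAlgebra V)

/-- Both sides equal `(L(-1)v)_{-1} 𝟏`, by creation and the derivative axiom. -/
theorem conformal_zero_apply (v : V) :
    vertexMode A.Y A.ω 0 v = vertexMode A.Y v (-2) A.vacuum := by
  have h := congrArg (fun T => T A.vacuum) (A.derivative v (-1))
  rw [A.creation] at h
  simpa using h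

theorem L_one_mem_weightSpace {k : ℤ} {v : V} (hv : v ∈ A.weightSpace k) :
    A.L 1 v ∈ A.weightSpace (k - 1) := by
  have h := congrArg (fun T => T v) (A.virasoro 0 1)
  have hv' : vertexMode A.Y A.ω 1 v = (k : ℂ) • v := by
    simpa [weightSpace, L, Module.End.mem_eigenspace_iff] using hv
  simp only [weightSpace, L, Module.End.mem_eigenspace_iff]
  simp [hv'] at h
  norm_num at h ⊢
  rw [sub_eq_iff_eq_add] at h
  rw [h]
  module

theorem L_one_pow_mem_weightSpace {k : ℤ} {v : V} (hv : v ∈ A.weightSpace k) (j : ℕ) :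
    (A.L 1 ^ j) v ∈ A.weightSpace (k - j) := by
  induction j with
  | zero => simpa using hv
  | succ j ih =>
    rw [pow_succ', Module.End.mul_apply]
    convert A.L_one_mem_weightSpace ih using 2
    push_cast
    ring

theorem weightProj_mem (k : ℤ) (v : V) : A.weightProj k v ∈ A.weightSpace k := by
  simp [weightProj]

theorem finite_weightProj_ne_zero (v : V) : {k : ℤ | A.weightProj k v ≠ 0}.Finite := by
  classical
  refine (DFinsupp.support ((LinearEquiv.ofBijective (DirectSum.coeLinearMap A.weightSpace)
    A.isInternal_weightSpace).symm v)).finite_toSet.subset fun k hk => ?_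
  rw [Finset.mem_coe, DFinsupp.mem_support_iff]
  intro h0
  apply hk
  simp only [weightProj, LinearMap.comp_apply]
  exact congrArg Subtype.val h0

theorem weightProj_of_mem {m : ℤ} (k : ℤ) {v : V} (hv : v ∈ A.weightSpace m) :
    A.weightProj k v = if k = m then v else 0 := by
  have h : (LinearEquiv.ofBijective (DirectSum.coeLinearMap A.weightSpace)
      A.isInternal_weightSpace).symm v =
      DirectSum.lof ℂ ℤ (fun k => A.weightSpace k) m ⟨v, hv⟩ := by
    rw [LinearEquiv.symm_apply_eq]
    exact (DirectSum.coeLinearMap_lof (R := ℂ) A.weightSpace m ⟨v, hv⟩).symm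
  simp only [weightProj, LinearMap.comp_apply, LinearEquiv.coe_coe, h]
  split_ifs with hk
  · subst hk
    simp [DirectSum.component.lof_self]
  · rw [DirectSum.component.of, dif_neg (Ne.symm hk)]
    simp

theorem IsIntegralForm.weightProj_mem {A : VertexOperatorAlgebra V} {VZ : Submodule ℤ V}
    (h : A.IsIntegralForm VZ) (k : ℤ) {v : V} (hv : v ∈ VZ) : A.weightProj k v ∈ VZ := by
  rw [h.graded] at hv
  induction hv using Submodule.iSup_induction' with
  | mem m x hx =>
    rw [A.weightProj_of_mem k hx.1]
    split_ifs
    exacts [hx.2, zero_mem _]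
  | zero => simp
  | add x y _ _ hx hy => rw [map_add]; exact add_mem hx hy

/-! ### Weight shifts and integrality on `W`. -/

namespace Mod

variable {A} {W : Type*} [AddCommGroup W] [Module ℂ W] (M : A.Mod W)

/-- The `L(-1)`-derivative property holds on every module. -/
theorem derivative (v : V) (n : ℤ) (x : W) :
    vertexMode M.Y (vertexMode A.Y A.ω 0 v) n x = (-n) • vertexMode M.Y v (n - 1) x := by
  -- These are the coefficients of `(1 - t)^(-2)`.
  have hc (i : ℕ) : ((-1) ^ i * Ring.choose (-2) i : ℤ) = i + 1 := by
    rw [Ring.choose_neg', Ring.multichoose_two, Units.smul_def, smul_eq_mul, ← mul_assoc]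
    simp [Int.negOnePow_def, ← mul_pow]
  -- As `L(-1)v = v_{-2} 𝟏`, pairing `v` with the vacuum isolates its modes. Vacuum modes vanish
  -- except at index `-1`, so each sum on the left has at most one term: the first contributes only
  -- for `n < 0`, the second only for `n > 0`.
  have h := M.jacobi v A.vacuum x (-2) 0 n
  simp only [M.vacuum_mode, hc] at h
  rw [A.conformal_zero_apply]
  rw [finsum_eq_single (fun i : ℕ => (Ring.choose (0 : ℤ) i : ℤ) • _) 0 (fun i hi => by
    simp [Ring.choose_zero_pos ℤ (Nat.pos_of_ne_zero hi)])] at h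
  simp at h
  have h1 : ∑ᶠ i : ℕ, ((i : ℤ) + 1) • vertexMode M.Y v (-2 - i)
      ((if n + i = -1 then (1 : Module.End ℂ W) else 0) x) =
      if n < 0 then (-n) • vertexMode M.Y v (n - 1) x else 0 := by
    split_ifs with hn
    · obtain ⟨m, rfl⟩ : ∃ m : ℕ, n = -1 - m := ⟨(-1 - n).toNat, by omega⟩
      rw [finsum_eq_single _ m fun i hi => by rw [if_neg (by omega)]; simp]
      rw [if_pos (by omega), show (-2 - m : ℤ) = -1 - m - 1 by ring,
        show ((m : ℤ) + 1) = -(-1 - m) by ring]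
      simp
    · exact finsum_eq_zero_of_forall_eq_zero fun i => by rw [if_neg (by omega)]; simp
  have h2 : ∑ᶠ i : ℕ, (((i : ℤ) + 1) * (Int.negOnePow 2 : ℤ)) •
      (if n + -2 - i = -1 then (1 : Module.End ℂ W) else 0) (vertexMode M.Y v i x) =
      if 0 < n then n • vertexMode M.Y v (n - 1) x else 0 := by
    rw [Int.negOnePow_even 2 even_two]
    split_ifs with hn
    · obtain ⟨m, rfl⟩ : ∃ m : ℕ, n = m + 1 := ⟨(n - 1).toNat, by omega⟩
      rw [finsum_eq_single _ m fun i hi => by rw [if_neg (by omega)]; simp]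
      rw [if_pos (by omega)]
      simp
    · exact finsum_eq_zero_of_forall_eq_zero fun i => by rw [if_neg (by omega)]; simp
  rw [← h, h1, h2]
  rcases lt_trichotomy n 0 with hn | rfl | hn
  · simp [hn, hn.le]
  · simp
  · simp [hn, hn.le]

/-- Since `ω_1 = L(0)`, the commutator formula and the derivative property give `[L(0), v_n] = (k -
n - 1) v_n`. -/
theorem vertexMode_mem_weightSpace {k : ℤ} {v : V} (hv : v ∈ A.weightSpace k) {h : ℂ} {x : W}
    (hx : x ∈ M.weightSpace h) (n : ℤ) :
    vertexMode M.Y v n x ∈ M.weightSpace (h + k - n - 1) := by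
  have hv' : vertexMode A.Y A.ω 1 v = (k : ℂ) • v := by
    simpa [VertexOperatorAlgebra.weightSpace, L, Module.End.mem_eigenspace_iff] using hv
  rw [weightSpace, Module.End.mem_eigenspace_iff] at hx ⊢
  have hs : vertexMode M.Y ((k : ℂ) • v) n x = (k : ℂ) • vertexMode M.Y v n x := by
    simp [vertexMode]
  have h1 := M.jacobi.commutator_one A.ω v x n
  rw [hx, hv', M.derivative, hs, map_smul, sub_eq_iff_eq_add, add_sub_cancel_right] at h1
  rw [h1, ← Int.cast_smul_eq_zsmul ℂ]
  push_cast
  module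

theorem oppositeMode_mem_of_integral {VZ : Submodule ℤ V} (hVZ : A.IsIntegralForm VZ)
    {WZ : Submodule ℤ W} (hWZ : M.IsIntegralForm VZ WZ)
    (hL : ∀ (n : ℕ), ∀ v ∈ VZ, ((n.factorial : ℂ)⁻¹) • (A.L 1 ^ n) v ∈ VZ)
    {v : V} (hv : v ∈ VZ) (n : ℤ) {x : W} (hx : x ∈ WZ) : M.oppositeMode v n x ∈ WZ := by
  -- Termwise membership suffices: a `finsum` of infinite support is `0`, so no finiteness has to be
  -- checked.
  refine finsum_induction (fun T : Module.End ℂ W => T x ∈ WZ) (by simp)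
    (fun _ _ hS hT => add_mem hS hT) fun k => ?_
  refine finsum_induction (fun T : Module.End ℂ W => T x ∈ WZ) (by simp)
    (fun _ _ hS hT => add_mem hS hT) fun j => ?_
  have hmem := hWZ.mode_mem _ (hL j _ (hVZ.weightProj_mem k hv)) x hx (2 * k - j - n - 2)
  have hs : vertexMode M.Y ((j.factorial : ℂ)⁻¹ • (A.L 1 ^ j) (A.weightProj k v))
      (2 * k - j - n - 2) x = (j.factorial : ℂ)⁻¹ • vertexMode M.Y
        ((A.L 1 ^ j) (A.weightProj k v)) (2 * k - j - n - 2) x := by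
    simp [vertexMode]
  rw [hs] at hmem
  rw [LinearMap.smul_apply, div_eq_mul_inv, mul_smul]
  rcases Int.even_or_odd k with hk | hk
  · simpa [hk.neg_one_zpow] using hmem
  · simpa [hk.neg_one_zpow] using hmem

theorem contragredientMode_mem_contragredient (v : V) (n : ℤ) {f : Module.Dual ℂ W}
    (hf : f ∈ M.contragredient) : M.contragredientMode v n f ∈ M.contragredient := by
  -- The weights of `W` that some component of `v` can send into the finite set of weights where `f`
  -- is nonzero.
  have hfin : (⋃ k ∈ {k : ℤ | A.weightProj k v ≠ 0},
      (fun h : ℂ => h + (n + 1 - k)) ⁻¹' {h : ℂ | ¬ M.weightSpace h ≤ LinearMap.ker f}).Finite :=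
    (A.finite_weightProj_ne_zero v).biUnion fun k _ =>
      Set.Finite.preimage (add_left_injective _).injOn hf
  refine hfin.subset fun h hh => ?_
  by_contra hcon
  simp only [Set.mem_iUnion, Set.mem_preimage, Set.mem_ofPred_eq, not_exists, not_not] at hcon
  refine hh fun x hx => ?_
  change f (M.oppositeMode v n x) = 0
  refine finsum_induction (fun T : Module.End ℂ W => f (T x) = 0) (by simp)
    (fun _ _ hS hT => by simp [hS, hT]) fun k => ?_
  refine finsum_induction (fun T : Module.End ℂ W => f (T x) = 0) (by simp)
    (fun _ _ hS hT => by simp [hS, hT]) fun j => ?_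
  by_cases hk : A.weightProj k v = 0
  · simp [hk, vertexMode]
  · have hm := M.vertexMode_mem_weightSpace
      (A.L_one_pow_mem_weightSpace (A.weightProj_mem k v) j) hx (2 * k - j - n - 2)
    -- `L(1)^j` lowers the weight by `j`, which cancels the `-j` in the mode index.
    have he : h + ((k - j : ℤ) : ℂ) - ((2 * k - j - n - 2 : ℤ) : ℂ) - 1 = h + (n + 1 - k) := by
      push_cast
      ring
    rw [he] at hm
    have h0 := LinearMap.mem_ker.1 (hcon k hk hm)
    simp [h0]

end Mod

end VertexOperatorAlgebra

end Modes

theorem mainTheorem12 {V : Type*} [AddCommGroup V] [Module ℂ V] (A : VertexOperatorAlgebra V)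
    {W : Type*} [AddCommGroup W] [Module ℂ W] (M : A.Mod W)
    (VZ : Submodule ℤ V) (hVZ : A.IsIntegralForm VZ)
    (WZ : Submodule ℤ W) (hWZ : M.IsIntegralForm VZ WZ)
    (hL : ∀ (n : ℕ), ∀ v ∈ VZ, ((n.factorial : ℂ)⁻¹) • (A.L 1 ^ n) v ∈ VZ) :
    ∀ v ∈ VZ, ∀ f ∈ M.dualLattice WZ, ∀ n : ℤ, M.contragredientMode v n f ∈ M.dualLattice WZ :=
  fun v hv _ hf n => ⟨M.contragredientMode_mem_contragredient v n hf.1, fun _ hx =>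
    hf.2 _ (M.oppositeMode_mem_of_integral hVZ hWZ hL hv n hx)⟩
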